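/- Let $k$ be an algebraically closed field, let $R=\bigoplus_{i\in\mathbb Z}R_i$ be a $\mathbb Z$-graded associative unital $k$-algebra that is finitely generated as a $k$-algebra, and let $M$ be a finite-dimensional (ungraded) left $R$-module, $d=\dim_k M$. Call $M$ \emph{gradable} if there is a decomposition of vector spaces $M=\bigoplus_{j\in\mathbb Z}M_j$ with $R_iM_j\subseteq M_{i+j}$ for all $i,j\in\mathbb Z$. The \emph{variety of $d$-dimensional $R$-modules} is the set of all $k$-algebra homomorphisms $\rho\colon R\to \mathrm{Mat}_{d}(k)$ with the Zariski topology (given by the matrix entries of $\rho(r_1),\dots,\rho(r_n)$ for generators $r_1,\dots,r_n$ of $R$; it does not depend on the choice of generators), and $\mathrm{GL}_d(k)$ acts on it by $(g\cdot\rho)(r)=g\rho(r)g^{-1}$. We say that $M$ \emph{has an open orbit} if the $\mathrm{GL}_d(k)$-orbit of the point given by $M$ and a $k$-basis of $M$ is open in this variety. Then: \begin{enumerate} \item if $M$ has an open orbit, then $M$ is gradable; \item if $\operatorname{Ext}^1_R(M,M)=0$, then $M$ is gradable. \end{enumerate} -/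

import Mathlib

open CategoryTheory

universe u v w

/-- The Zariski topology on the affine space `k^σ`: the basic open sets are the
non-vanishing loci of polynomials. -/
@[reducible] def zariskiTopology (k σ : Type*) [Field k] : TopologicalSpace (σ → k) :=
  TopologicalSpace.generateFrom
    {U | ∃ p : MvPolynomial σ k, U = {x | MvPolynomial.eval x p ≠ 0}}

/-- The variety of `d`-dimensional `R`-modules: its points are the `R`-module structures on
`k^d`, that is, the `k`-algebra homomorphisms from `R` to the `d × d` matrices over `k`. -/
structure ModuleVariety (k R : Type*) [Field k] [Ring R] [Algebra k R] (d : ℕ) where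
  /-- The representation of `R` on `k^d` given by the point. -/
  rep : R →ₐ[k] Matrix (Fin d) (Fin d) k

namespace ModuleVariety

variable {k R : Type*} [Field k] [Ring R] [Algebra k R] {d : ℕ}

/-- The matrix entries of the action of all elements of `R`. -/
def coords (x : ModuleVariety k R d) : R × Fin d × Fin d → k :=
  fun e => x.rep e.1 e.2.1 e.2.2

/-- The matrix entries of the action of the members of a family `s` in `R`. When `s` is a
finite family of generators of `R`, this is the usual embedding of the module variety as a
closed subset of affine space. -/
def coordsOf {ι : Type*} (s : ι → R) (x : ModuleVariety k R d) : ι × Fin d × Fin d → k :=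
  fun e => x.rep (s e.1) e.2.1 e.2.2

/-- The Zariski topology on the module variety, without a choice of generators. By
`topology_eq_induced` it is the one given by the matrix entries of any family of generators. -/
instance : TopologicalSpace (ModuleVariety k R d) :=
  (zariskiTopology k (R × Fin d × Fin d)).induced coords

/-- The action of `GL_d(k)` on the module variety by base change, `(g • ρ)(r) = g ρ(r) g⁻¹`. -/
instance : MulAction (GL (Fin d) k) (ModuleVariety k R d) where
  smul g x :=
    { rep :=
        { toFun := fun r =>
            (g : Matrix (Fin d) (Fin d) k) * x.rep r *
              ((g⁻¹ : GL (Fin d) k) : Matrix (Fin d) (Fin d) k)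
          map_one' := by simp
          map_mul' := fun a b => by
            simp only [map_mul, mul_assoc, Units.inv_mul_cancel_left]
          map_zero' := by simp
          map_add' := fun a b => by simp only [map_add, mul_add, add_mul]
          commutes' := fun c => by
            rw [AlgHom.commutes, ← Algebra.commutes, mul_assoc, Units.mul_inv, mul_one] } }
  one_smul x := by
    obtain ⟨f⟩ := x
    change ModuleVariety.mk _ = _
    congr 1
    ext1 r
    change (1 : Matrix (Fin d) (Fin d) k) * f r * _ = _
    simp
  mul_smul g h x := by
    change ModuleVariety.mk _ = ModuleVariety.mk _
    congr 1
    ext1 r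
    change ((g * h : GL (Fin d) k) : Matrix (Fin d) (Fin d) k) * x.rep r *
      (((g * h)⁻¹ : GL (Fin d) k) : Matrix (Fin d) (Fin d) k) =
      (g : Matrix (Fin d) (Fin d) k) * ((h : Matrix (Fin d) (Fin d) k) * x.rep r *
        ((h⁻¹ : GL (Fin d) k) : Matrix (Fin d) (Fin d) k)) *
        ((g⁻¹ : GL (Fin d) k) : Matrix (Fin d) (Fin d) k)
    rw [mul_inv_rev, Units.val_mul, Units.val_mul]
    simp only [mul_assoc]

/-- The topology of the module variety is the Zariski topology given by the matrix entries of
any family that generates `R`. -/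
theorem topology_eq_induced {ι : Type*} (s : ι → R)
    (hs : Algebra.adjoin k (Set.range s) = ⊤) :
    (inferInstance : TopologicalSpace (ModuleVariety k R d)) =
      (zariskiTopology k (ι × Fin d × Fin d)).induced (coordsOf s) := by
  have key : ∀ r : R, ∀ a b : Fin d, ∃ p : MvPolynomial (ι × Fin d × Fin d) k,
      ∀ x : ModuleVariety k R d, MvPolynomial.eval (coordsOf s x) p = x.rep r a b := by
    intro r
    have hr : r ∈ Algebra.adjoin k (Set.range s) := hs ▸ Algebra.mem_top
    induction hr using Algebra.adjoin_induction with
    | mem r h =>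
      obtain ⟨i, rfl⟩ := h
      exact fun a b => ⟨MvPolynomial.X (i, a, b), fun x => by simp [coordsOf]⟩
    | algebraMap c =>
      intro a b
      refine ⟨MvPolynomial.C (algebraMap k (Matrix (Fin d) (Fin d) k) c a b), fun x => ?_⟩
      rw [MvPolynomial.eval_C, AlgHom.commutes]
    | add r t _ _ h₁ h₂ =>
      intro a b
      obtain ⟨p, hp⟩ := h₁ a b
      obtain ⟨q, hq⟩ := h₂ a b
      exact ⟨p + q, fun x => by simp [hp, hq]⟩
    | mul r t _ _ h₁ h₂ =>
      intro a b
      choose p hp using h₁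
      choose q hq using h₂
      exact ⟨∑ c, p a c * q c b, fun x => by simp [hp, hq, Matrix.mul_apply]⟩
  choose P hP using key
  change (zariskiTopology k (R × Fin d × Fin d)).induced coords = _
  unfold zariskiTopology
  rw [induced_generateFrom_eq, induced_generateFrom_eq]
  congr 1
  ext U
  constructor
  · rintro ⟨_, ⟨p, rfl⟩, rfl⟩
    refine ⟨_, ⟨MvPolynomial.bind₁ (fun e => P e.1 e.2.1 e.2.2) p, rfl⟩, ?_⟩
    ext x
    have h : (fun e : R × Fin d × Fin d =>
        MvPolynomial.eval (coordsOf s x) (P e.1 e.2.1 e.2.2)) = coords x :=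
      funext fun e => hP _ _ _ x
    simp only [Set.mem_preimage, Set.mem_ofPred_eq]
    rw [MvPolynomial.eval, MvPolynomial.eval₂Hom_bind₁]
    exact not_congr (by rw [← h]; rfl)
  · rintro ⟨_, ⟨p, rfl⟩, rfl⟩
    refine ⟨_, ⟨MvPolynomial.rename (fun e => (s e.1, e.2)) p, rfl⟩, ?_⟩
    ext x
    simp only [Set.mem_preimage, Set.mem_ofPred_eq, MvPolynomial.eval_rename]
    rfl

end ModuleVariety

/-- The point of the variety of `(dim M)`-dimensional `R`-modules given by `M` and a basis
of `M`. The orbit of this point does not depend on the basis. -/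
noncomputable def modulePoint (k R M : Type*) [Field k] [Ring R] [Algebra k R] [AddCommGroup M]
    [Module k M] [Module R M] [IsScalarTower k R M] [FiniteDimensional k M] :
    ModuleVariety k R (Module.finrank k M) :=
  ⟨((LinearMap.toMatrixAlgEquiv (Module.finBasis k M)).toAlgHom).comp (Algebra.lsmul k k M)⟩

/-- `M` has an open orbit: the `GL`-orbit of `M` is open in the variety of
`(dim M)`-dimensional `R`-modules. -/
def HasOpenOrbit (k R M : Type*) [Field k] [Ring R] [Algebra k R] [AddCommGroup M]
    [Module k M] [Module R M] [IsScalarTower k R M] [FiniteDimensional k M] : Prop :=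
  IsOpen (MulAction.orbit (GL (Fin (Module.finrank k M)) k) (modulePoint k R M))

/-- `M` is gradable: it is the underlying module of a `ℤ`-graded module over the `ℤ`-graded
algebra `R = ⨁ 𝒜 i`. -/
def IsGradable {k R : Type*} [Field k] [Ring R] [Algebra k R] (𝒜 : ℤ → Submodule k R)
    (M : Type*) [AddCommGroup M] [Module k M] [Module R M] : Prop :=
  ∃ ℳ : ℤ → Submodule k M, DirectSum.IsInternal ℳ ∧
    ∀ (i j : ℤ) (r : R) (m : M), r ∈ 𝒜 i → m ∈ ℳ j → r • m ∈ ℳ (i + j)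

/-! A unit `t` acts on `R` by the automorphism multiplying degree `i` by `t ^ i`, and `M` can be
twisted by it. Suppose `g` is an isomorphism of `M` with its twist. An element of degree `i` then
carries the generalized eigenspace of `g` for `μ` into the one for `t ^ i * μ`, so the eigenspaces
can be assembled into a grading once the eigenvalues receive compatible integer degrees. `R` is
generated in degrees at most `N` in absolute value, so it is enough that `t ^ n ≠ 1` for `0 < n ≤
(dim M + 1) * N`. A unit of infinite order, absent over the algebraic closure of a finite field, is
not needed (`isGradable_of_twist`).

Open orbit: the twists of the point of `M` form an algebraic curve through it at `t = 1`, so all but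
finitely many of them stay in the open orbit (`ModuleVariety.tendsto_twist`). As `kˣ` is infinite,
one of these `t` has no small order.

Vanishing `Ext`: every derivation `R → End M` is inner (`derivation_inner_of_subsingleton_ext`).
This removes the obstructions to building, coefficient by coefficient, a conjugation over `k⟦X⟧` of
`M` into its twist by `1 + X` (`exists_conjugating_series`). The Nullstellensatz specializes this
conjugation to `k` (`exists_specialization`). -/

/-! ### Integer degrees for eigenvalues -/

/-- Descend from `μ` through `t⁻¹ * μ`, `t⁻² * μ`, … and let `φ μ` be the number of steps before the
first `N` consecutive values outside `S`. Starting `n ≤ N` steps higher, at a point of `S`, delays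
this gap by exactly `n`. -/
theorem exists_twist_potential {k : Type*} [Field k] (S : Finset k) (hS : (0 : k) ∉ S) (N : ℕ)
    (t : kˣ) (ht : ∀ n, 0 < n → n ≤ (S.card + 1) * N → t ^ n ≠ 1) :
    ∃ φ : k → ℤ, ∀ μ ∈ S, ∀ i : ℤ, |i| ≤ N → ((t ^ i : kˣ) : k) * μ ∈ S →
      φ (((t ^ i : kˣ) : k) * μ) = φ μ + i := by
  classical
  let P : k → ℕ → Prop := fun μ m => ∀ j : ℕ, 1 ≤ j → j ≤ N →
    ((t ^ (-(m + j : ℤ)) : kˣ) : k) * μ ∉ S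
  have hex : ∀ μ ∈ S, ∃ m, P μ m := by
    intro μ hμ
    by_contra hcon
    simp only [P, not_exists, not_forall, not_not] at hcon
    choose j hj1 hjN hjS using hcon
    have hμ0 : μ ≠ 0 := fun h => hS (h ▸ hμ)
    -- Without a gap, each of the `S.card + 1` blocks of exponents `(q * N, (q + 1) * N]` meets `S`.
    -- The bound on the order of `t` makes these points distinct, which is too many.
    let a : ℕ → ℕ := fun q => q * N + j (q * N)
    have hlt : ∀ p q, p < q → a p < a q := by
      intro p q hpq
      have h1 := hjN (p * N)
      have h2 := hj1 (q * N)
      have h3 : (p + 1) * N ≤ q * N := Nat.mul_le_mul_right _ hpq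
      simp only [a]
      nlinarith
    have hne : ∀ p q : Fin (S.card + 1), p < q →
        ((t ^ (-(a p : ℤ)) : kˣ) : k) * μ ≠ ((t ^ (-(a q : ℤ)) : kˣ) : k) * μ := by
      intro p q hpq h
      have h1 := Units.ext (mul_right_cancel₀ hμ0 h)
      have h2 : a p < a q := hlt _ _ hpq
      have h3 : a q ≤ (S.card + 1) * N := by
        have h4 := hjN (q * N)
        have h5 : ((q : ℕ) + 1) * N ≤ (S.card + 1) * N := Nat.mul_le_mul_right _ q.2
        simp only [a]
        nlinarith
      refine ht (a q - a p) (by omega) (by omega) ?_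
      have h6 : t ^ ((a q : ℤ) - a p) = 1 := by
        rw [sub_eq_add_neg, zpow_add, h1, ← zpow_add, add_neg_cancel, zpow_zero]
      rw [← zpow_natCast, Nat.cast_sub h2.le, h6]
    have hinj : Function.Injective (fun q : Fin (S.card + 1) =>
        (⟨((t ^ (-(a q : ℤ)) : kˣ) : k) * μ, by
          have := hjS (q * N)
          simpa [a] using this⟩ : S)) := by
      intro p q hpq
      have h := congrArg Subtype.val hpq
      rcases lt_trichotomy p q with h' | h' | h'
      · exact (hne _ _ h' h).elim
      · exact h'
      · exact (hne _ _ h' h.symm).elim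
    have := Fintype.card_le_of_injective _ hinj
    simp at this
  let φ : k → ℤ := fun μ => if h : ∃ m, P μ m then (Nat.find h : ℤ) else 0
  have key : ∀ μ ∈ S, ∀ n : ℕ, n ≤ N → ((t ^ (n : ℤ) : kˣ) : k) * μ ∈ S →
      φ (((t ^ (n : ℤ) : kˣ) : k) * μ) = φ μ + n := by
    intro μ hμ n hn hμ'
    have h1 := hex _ hμ
    have h2 := hex _ hμ'
    simp only [φ, dif_pos h1, dif_pos h2]
    have shift : ∀ e : ℤ, ((t ^ e : kˣ) : k) * (((t ^ (n : ℤ) : kˣ) : k) * μ) =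
        ((t ^ (e + n) : kˣ) : k) * μ := by
      intro e
      rw [zpow_add, Units.val_mul, mul_assoc]
    suffices Nat.find h2 = Nat.find h1 + n by rw [this]; push_cast; rfl
    rw [Nat.find_eq_iff]
    constructor
    · intro j hj1 hjN
      rw [shift]
      have := Nat.find_spec h1 j hj1 hjN
      convert this using 5
      push_cast; ring
    · intro m hm hP
      -- No gap can start at `m < n`: its window would contain `μ` itself, at `j = n - m`.
      by_cases hmn : m < n
      · apply hP (n - m) (by omega) (by omega)
        rw [shift, Nat.cast_sub hmn.le]
        simpa using hμ
      · refine Nat.find_min h1 (m := m - n) (by omega) ?_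
        intro j hj1 hjN
        have := hP j hj1 hjN
        rw [shift] at this
        convert this using 5
        rw [Nat.cast_sub (not_lt.mp hmn)]; ring
  refine ⟨φ, fun μ hμ i hi hμ' => ?_⟩
  rcases le_total 0 i with h0 | h0
  · lift i to ℕ using h0
    exact key μ hμ i (by simpa using hi) hμ'
  · obtain ⟨n, rfl⟩ : ∃ n : ℕ, i = -n := ⟨i.natAbs, by omega⟩
    have h1 : ((t ^ (n : ℤ) : kˣ) : k) * (((t ^ (-n : ℤ) : kˣ) : k) * μ) = μ := by
      rw [← mul_assoc, ← Units.val_mul, ← zpow_add]; simp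
    have := key _ hμ' n (by simpa using hi) (by rw [h1]; exact hμ)
    rw [h1] at this
    omega

/-! ### From a twisted automorphism to a grading -/

section Grading

variable {k R M : Type*} [Field k] [Ring R] [Algebra k R] (𝒜 : ℤ → Submodule k R)
  [GradedAlgebra 𝒜] [AddCommGroup M] [Module k M] [Module R M] [IsScalarTower k R M]

/-- Degrees of eigenvalues are compatible only with bounded shifts, so the grading condition can be
tested directly only on components of generators. -/
theorem smul_mem_of_generators {s : Set R} (hs : Algebra.adjoin k s = ⊤) (ℳ : ℤ → Submodule k M)
    (h : ∀ r ∈ s, ∀ i j : ℤ, ∀ m ∈ ℳ j, (DirectSum.decompose 𝒜 r i : R) • m ∈ ℳ (i + j))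
    (i j : ℤ) (r : R) (m : M) (hr : r ∈ 𝒜 i) (hm : m ∈ ℳ j) : r • m ∈ ℳ (i + j) := by
  have key : ∀ r : R, ∀ i j : ℤ, ∀ m ∈ ℳ j,
      (DirectSum.decompose 𝒜 r i : R) • m ∈ ℳ (i + j) := by
    intro r
    have hr : r ∈ Algebra.adjoin k s := hs ▸ Algebra.mem_top
    induction hr using Algebra.adjoin_induction with
    | mem r hr => exact h r hr
    | algebraMap c =>
      intro i j m hm
      have hc : algebraMap k R c ∈ 𝒜 0 := SetLike.algebraMap_mem_graded 𝒜 c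
      by_cases hi : i = 0
      · subst hi
        rw [DirectSum.decompose_of_mem_same 𝒜 hc, algebraMap_smul, zero_add]
        exact (ℳ j).smul_mem c hm
      · rw [DirectSum.decompose_of_mem_ne 𝒜 hc (Ne.symm hi), zero_smul]
        exact zero_mem _
    | add r t _ _ h₁ h₂ =>
      intro i j m hm
      rw [DirectSum.decompose_add, DirectSum.add_apply, Submodule.coe_add, add_smul]
      exact add_mem (h₁ i j m hm) (h₂ i j m hm)
    | mul r t _ _ h₁ h₂ =>
      intro i j m hm
      classical
      rw [DirectSum.decompose_mul, DirectSum.coe_mul_apply, Finset.sum_smul]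
      refine sum_mem fun e he => ?_
      have he' := (Finset.mem_filter.mp he).2
      rw [mul_smul, ← he', add_assoc]
      exact h₁ _ _ _ (h₂ _ _ _ hm)
  have := key r i j m hm
  rwa [DirectSum.decompose_of_mem_same 𝒜 hr] at this

theorem exists_degree_bound (s : Finset R) :
    ∃ N : ℕ, ∀ r ∈ s, ∀ i : ℤ, (DirectSum.decompose 𝒜 r i : R) ≠ 0 → |i| ≤ N := by
  classical
  refine ⟨s.sup fun r => (DirectSum.decompose 𝒜 r).support.sup Int.natAbs, fun r hr i hi => ?_⟩
  rw [Int.abs_eq_natAbs, Nat.cast_le]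
  refine le_trans ?_ (Finset.le_sup (f := fun r =>
    (DirectSum.decompose 𝒜 r).support.sup Int.natAbs) hr)
  refine Finset.le_sup (f := Int.natAbs) ?_
  rw [DFinsupp.mem_support_iff]
  exact fun h => hi (by rw [h]; rfl)

/-- The twisted commutation gives `(g - c * μ) ^ n ∘ r = c ^ n • r ∘ (g - μ) ^ n`. -/
theorem smul_mem_maxGenEigenspace (g : Module.End k M) (c : k) (r : R)
    (h : ∀ m, g (r • m) = c • r • g m) (μ : k) {m : M} (hm : m ∈ g.maxGenEigenspace μ) :
    r • m ∈ g.maxGenEigenspace (c * μ) := by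
  rw [Module.End.mem_maxGenEigenspace] at hm ⊢
  obtain ⟨n, hn⟩ := hm
  refine ⟨n, ?_⟩
  have : ∀ n : ℕ, ∀ m : M, ((g - (c * μ) • (1 : Module.End k M)) ^ n) (r • m) =
      c ^ n • r • ((g - μ • (1 : Module.End k M)) ^ n) m := by
    intro n
    induction n with
    | zero => intro m; simp
    | succ n ih =>
      intro m
      rw [pow_succ (g - _), pow_succ (g - _), Module.End.mul_apply, Module.End.mul_apply]
      have : (g - (c * μ) • (1 : Module.End k M)) (r • m) =
          r • c • (g - μ • (1 : Module.End k M)) m := by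
        simp only [LinearMap.sub_apply, LinearMap.smul_apply, Module.End.one_apply, h, smul_sub,
          mul_smul, smul_comm r]
      rw [this, ih, map_smul, pow_succ, mul_smul, smul_comm r c]
  rw [this, hn, smul_zero, smul_zero]

variable [IsAlgClosed k] [FiniteDimensional k M]

theorem isGradable_of_twist {s : Finset R} (hs : Algebra.adjoin k (s : Set R) = ⊤) {N : ℕ}
    (hN : ∀ r ∈ s, ∀ i : ℤ, (DirectSum.decompose 𝒜 r i : R) ≠ 0 → |i| ≤ N) (t : kˣ)
    (ht : ∀ n, 0 < n → n ≤ (Module.finrank k M + 1) * N → t ^ n ≠ 1)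
    (g : Module.End k M) (hg : Function.Injective g)
    (h : ∀ i : ℤ, ∀ r ∈ 𝒜 i, ∀ m, g (r • m) = ((t ^ i : kˣ) : k) • r • g m) :
    IsGradable 𝒜 M := by
  classical
  have hind := Module.End.independent_maxGenEigenspace g
  have hfin : {μ | g.maxGenEigenspace μ ≠ ⊥}.Finite :=
    WellFoundedGT.finite_ne_bot_of_iSupIndep hind
  let S : Finset k := hfin.toFinset
  have hmemS : ∀ μ, μ ∈ S ↔ g.maxGenEigenspace μ ≠ ⊥ := fun μ => by simp [S]
  have hcard : S.card ≤ Module.finrank k M := by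
    let : Fintype {μ // g.maxGenEigenspace μ ≠ ⊥} := hfin.fintype
    have hS : S.card = Fintype.card {μ // g.maxGenEigenspace μ ≠ ⊥} :=
      (Fintype.card_of_subtype S hmemS).symm
    exact hS ▸ iSupIndep.subtype_ne_bot_le_finrank hind
  have h0 : (0 : k) ∉ S := by
    rw [hmemS, not_not, eq_bot_iff]
    intro m hm
    obtain ⟨n, hn⟩ := (Module.End.mem_maxGenEigenspace _ _ _).mp hm
    rw [zero_smul, sub_zero, Module.End.pow_apply] at hn
    exact (hg.iterate n) (by rw [hn, ← Module.End.pow_apply, map_zero])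
  obtain ⟨φ, hφ⟩ := exists_twist_potential S h0 N t fun n h1 h2 => ht n h1 (h2.trans (by gcongr))
  -- The values of `φ` outside `S` are irrelevant, since those generalized eigenspaces are zero.
  let ℳ : ℤ → Submodule k M := fun j => ⨆ μ ∈ {μ | φ μ = j}, g.maxGenEigenspace μ
  have hle : ∀ μ, g.maxGenEigenspace μ ≤ ℳ (φ μ) := fun μ =>
    le_iSup₂_of_le (f := fun ν (_ : ν ∈ {ν | φ ν = φ μ}) => g.maxGenEigenspace ν)
      μ rfl le_rfl
  refine ⟨ℳ, ?_, ?_⟩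
  · rw [DirectSum.isInternal_submodule_iff_iSupIndep_and_iSup_eq_top]
    constructor
    · intro j
      refine (hind.disjoint_biSup_biSup (s := {μ | φ μ = j}) (t := {μ | φ μ ≠ j}) ?_).mono_right ?_
      · exact Set.disjoint_left.mpr fun μ h1 h2 => h2 h1
      · refine iSup₂_le fun j' hj' => iSup₂_le fun μ hμ => ?_
        exact le_iSup₂_of_le (f := fun ν (_ : ν ∈ {ν | φ ν ≠ j}) => g.maxGenEigenspace ν)
          μ (by rw [Set.mem_ofPred_eq] at hμ ⊢; rwa [hμ]) le_rfl
    · rw [eq_top_iff, ← Module.End.iSup_maxGenEigenspace_eq_top g]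
      exact iSup_le fun μ => (hle μ).trans (le_iSup ℳ _)
  · refine smul_mem_of_generators 𝒜 hs ℳ ?_
    intro r hr i j m hm
    by_cases hri : (DirectSum.decompose 𝒜 r i : R) = 0
    · rw [hri, zero_smul]; exact zero_mem _
    have hi := hN r hr i hri
    set r' : R := (DirectSum.decompose 𝒜 r i : R) with hr'
    suffices ℳ j ≤ (ℳ (i + j)).comap (Algebra.lsmul k k M r') from this hm
    refine iSup₂_le fun μ hμ m hm => ?_
    suffices r' • m ∈ ℳ (i + j) from this
    have hmem := smul_mem_maxGenEigenspace g _ r' (h i r' (SetLike.coe_mem _)) μ hm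
    by_cases h1 : μ ∈ S
    · by_cases h2 : ((t ^ i : kˣ) : k) * μ ∈ S
      · have := hφ μ h1 i hi h2
        rw [Set.mem_ofPred_eq] at hμ
        rw [← hμ, add_comm, ← this]
        exact hle _ hmem
      · rw [hmemS, not_not] at h2
        rw [h2, Submodule.mem_bot] at hmem
        rw [hmem]; exact zero_mem _
    · rw [hmemS, not_not] at h1
      rw [h1, Submodule.mem_bot] at hm
      rw [hm, smul_zero]; exact zero_mem _

end Grading

/-! ### Rescaling homogeneous components -/

section Scale

variable {k R : Type*} [Field k] [Ring R] [Algebra k R] (𝒜 : ℤ → Submodule k R)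
  [GradedAlgebra 𝒜]

/-- The `k`-linear endomorphism of a graded algebra that multiplies the elements of degree `i`
by the scalar `c i`. -/
noncomputable def gradedScale (c : ℤ → k) : R →ₗ[k] R :=
  DirectSum.toModule k ℤ R (fun i => c i • (𝒜 i).subtype) ∘ₗ
    (DirectSum.decomposeLinearEquiv 𝒜).toLinearMap

theorem gradedScale_of_mem (c : ℤ → k) {i : ℤ} {r : R} (hr : r ∈ 𝒜 i) :
    gradedScale 𝒜 c r = c i • r := by
  lift r to 𝒜 i using hr
  simp [gradedScale]

theorem gradedScale_one (c : ℤ → k) : gradedScale 𝒜 c 1 = c 0 • 1 :=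
  gradedScale_of_mem 𝒜 c SetLike.GradedOne.one_mem

/-- Two biadditive expressions in elements of a graded algebra agree if they agree on
homogeneous elements. -/
theorem bilinear_ext_of_homogeneous {A : Type*} [AddCommGroup A] [Module k A]
    (B C : R →ₗ[k] R →ₗ[k] A)
    (h : ∀ i j : ℤ, ∀ r ∈ 𝒜 i, ∀ s ∈ 𝒜 j, B r s = C r s) (r s : R) : B r s = C r s := by
  suffices B = C by rw [this]
  refine DirectSum.decompose_lhom_ext 𝒜 fun i => LinearMap.ext fun r => ?_
  refine DirectSum.decompose_lhom_ext 𝒜 fun j => LinearMap.ext fun s => ?_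
  exact h i j r r.2 s s.2

/-- The automorphism of a `ℤ`-graded algebra given by a unit `t`: it multiplies the elements of
degree `i` by `t ^ i`. -/
noncomputable def gradedTwist (t : kˣ) : R →ₐ[k] R :=
  AlgHom.ofLinearMap (gradedScale 𝒜 fun i => ((t ^ i : kˣ) : k))
    (by rw [gradedScale_one]; simp)
    (bilinear_ext_of_homogeneous 𝒜 ((LinearMap.mul k R).compr₂ (gradedScale 𝒜 _))
      ((LinearMap.mul k R).compl₁₂ (gradedScale 𝒜 _) (gradedScale 𝒜 _)) fun i j r hr s hs => by
        simp only [LinearMap.compr₂_apply, LinearMap.compl₁₂_apply, LinearMap.mul_apply',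
          gradedScale_of_mem 𝒜 _ hr, gradedScale_of_mem 𝒜 _ hs,
          gradedScale_of_mem 𝒜 _ (SetLike.GradedMul.mul_mem hr hs), zpow_add, Units.val_mul,
          smul_mul_smul_comm])

theorem gradedTwist_of_mem (t : kˣ) {i : ℤ} {r : R} (hr : r ∈ 𝒜 i) :
    gradedTwist 𝒜 t r = ((t ^ i : kˣ) : k) • r :=
  gradedScale_of_mem 𝒜 _ hr

theorem gradedTwist_one : gradedTwist 𝒜 (1 : kˣ) = AlgHom.id k R := by
  apply AlgHom.toLinearMap_injective
  refine DirectSum.decompose_lhom_ext 𝒜 fun i => LinearMap.ext fun r => ?_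
  simp [gradedTwist_of_mem 𝒜 1 r.2]

end Scale

/-! ### Modules with an open orbit -/

section OpenOrbit

variable {k : Type*} [Field k]

/-- The ring of Laurent polynomial functions on `kˣ`. -/
noncomputable def laurentFunctions (k : Type*) [Field k] : Subring (kˣ → k) :=
  (RingHom.pi fun t : kˣ => LaurentPolynomial.eval₂ (RingHom.id k) t).range

theorem const_mem_laurentFunctions (c : k) : (fun _ : kˣ => c) ∈ laurentFunctions k :=
  ⟨LaurentPolynomial.C c, funext fun t => LaurentPolynomial.eval₂_C _ t c⟩

theorem zpow_mem_laurentFunctions (i : ℤ) :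
    (fun t : kˣ => ((t ^ i : kˣ) : k)) ∈ laurentFunctions k :=
  ⟨LaurentPolynomial.T i, funext fun t => LaurentPolynomial.eval₂_T _ t i⟩

theorem finite_zeros_of_mem_laurentFunctions {f : kˣ → k} (hf : f ∈ laurentFunctions k)
    {t₀ : kˣ} (h : f t₀ ≠ 0) : {t | f t = 0}.Finite := by
  classical
  obtain ⟨q, rfl⟩ := hf
  obtain ⟨n, p, hp⟩ := q.exists_T_pow
  have hev : ∀ t : kˣ, p.eval (t : k) =
      LaurentPolynomial.eval₂ (RingHom.id k) t q * ((t ^ (n : ℤ) : kˣ) : k) := by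
    intro t
    rw [← LaurentPolynomial.eval₂_T (RingHom.id k) t, ← map_mul, ← hp,
      LaurentPolynomial.eval₂_toLaurent]
    rfl
  have hp0 : p ≠ 0 := by
    rintro rfl
    have := hev t₀
    rw [Polynomial.eval_zero, eq_comm, mul_eq_zero] at this
    exact this.elim h (Units.ne_zero _)
  refine Set.Finite.of_finite_image (f := fun t : kˣ => (t : k))
    (p.roots.toFinset.finite_toSet.subset ?_) Units.val_injective.injOn
  rintro _ ⟨t, ht, rfl⟩
  have ht' : LaurentPolynomial.eval₂ (RingHom.id k) t q = 0 := ht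
  simp [hp0, hev, ht']

variable {R : Type*} [Ring R] [Algebra k R] (𝒜 : ℤ → Submodule k R) [GradedAlgebra 𝒜] {d : ℕ}

/-- The twist of a point of the module variety by a unit. -/
noncomputable def ModuleVariety.twist (x : ModuleVariety k R d) (t : kˣ) : ModuleVariety k R d :=
  ⟨x.rep.comp (gradedTwist 𝒜 t)⟩

theorem ModuleVariety.twist_one (x : ModuleVariety k R d) : x.twist 𝒜 1 = x := by
  obtain ⟨f⟩ := x
  simp [ModuleVariety.twist, gradedTwist_one]

theorem ModuleVariety.coords_twist_mem (x : ModuleVariety k R d) (e : R × Fin d × Fin d) :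
    (fun t => (x.twist 𝒜 t).coords e) ∈ laurentFunctions k := by
  obtain ⟨r, a, b⟩ := e
  induction r using DirectSum.Decomposition.inductionOn 𝒜 with
  | zero => simpa [coords] using const_mem_laurentFunctions (0 : k)
  | @homogeneous i r =>
    have : (fun t => (x.twist 𝒜 t).coords ((r : R), a, b)) =
        (fun t : kˣ => ((t ^ i : kˣ) : k)) * fun _ => x.rep r a b := by
      funext t
      simp [coords, twist, gradedTwist_of_mem 𝒜 t r.2]
    rw [this]
    exact mul_mem (zpow_mem_laurentFunctions i) (const_mem_laurentFunctions _)
  | add r s hr hs =>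
    have : (fun t => (x.twist 𝒜 t).coords (r + s, a, b)) =
        (fun t => (x.twist 𝒜 t).coords (r, a, b)) + fun t => (x.twist 𝒜 t).coords (s, a, b) := by
      funext t
      simp [coords]
    rw [this]
    exact add_mem hr hs

theorem ModuleVariety.eval_coords_twist_mem (x : ModuleVariety k R d)
    (p : MvPolynomial (R × Fin d × Fin d) k) :
    (fun t => MvPolynomial.eval (x.twist 𝒜 t).coords p) ∈ laurentFunctions k := by
  induction p using MvPolynomial.induction_on with
  | C c => simpa using const_mem_laurentFunctions c
  | add p q hp hq =>
    simp only [map_add]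
    exact add_mem hp hq
  | mul_X p e hp =>
    simp only [map_mul, MvPolynomial.eval_X]
    exact mul_mem hp (x.coords_twist_mem 𝒜 e)

/-- A basic open neighbourhood pulls back to the nonvanishing locus of a Laurent polynomial in `t`.
It is nonzero at `t = 1`, where the twist is `x`, hence has finitely many zeros. -/
theorem ModuleVariety.tendsto_twist (x : ModuleVariety k R d) :
    Filter.Tendsto (x.twist 𝒜) Filter.cofinite (nhds x) := by
  let := zariskiTopology k (R × Fin d × Fin d)
  rw [nhds_induced ModuleVariety.coords, Filter.tendsto_comap_iff]
  refine TopologicalSpace.tendsto_nhds_generateFrom_iff.mpr ?_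
  rintro _ ⟨p, rfl⟩ hx
  have := finite_zeros_of_mem_laurentFunctions (x.eval_coords_twist_mem 𝒜 p) (t₀ := 1)
    (by rw [x.twist_one 𝒜]; exact hx)
  rw [Filter.mem_cofinite]
  convert this using 1
  ext t
  simp

theorem eventually_pow_ne_one (L : ℕ) :
    ∀ᶠ t : kˣ in Filter.cofinite, ∀ n, 0 < n → n ≤ L → t ^ n ≠ 1 := by
  have : ∀ n ∈ Finset.Icc 1 L, ∀ᶠ t : kˣ in Filter.cofinite, t ^ n ≠ 1 := by
    intro n hn
    have : NeZero n := ⟨by have := (Finset.mem_Icc.mp hn).1; omega⟩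
    rw [Filter.eventually_cofinite]
    simp only [not_not]
    exact (Set.finite_range (Subtype.val : rootsOfUnity n k → kˣ)).subset
      fun t ht => ⟨⟨t, (mem_rootsOfUnity n t).mpr ht⟩, rfl⟩
  filter_upwards [(Filter.eventually_all_finset _).mpr this] with t ht n h1 h2
  exact ht n (Finset.mem_Icc.mpr ⟨h1, h2⟩)

variable [IsAlgClosed k] {M : Type*} [AddCommGroup M] [Module k M] [Module R M]
  [IsScalarTower k R M] [FiniteDimensional k M]

theorem isGradable_of_matrix {s : Finset R} (hs : Algebra.adjoin k (s : Set R) = ⊤) {N : ℕ}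
    (hN : ∀ r ∈ s, ∀ i : ℤ, (DirectSum.decompose 𝒜 r i : R) ≠ 0 → |i| ≤ N) (t : kˣ)
    (ht : ∀ n, 0 < n → n ≤ (Module.finrank k M + 1) * N → t ^ n ≠ 1)
    (g : Matrix (Fin (Module.finrank k M)) (Fin (Module.finrank k M)) k) (hg : IsUnit g)
    (h : ∀ i : ℤ, ∀ r ∈ 𝒜 i, g * (modulePoint k R M).rep r =
      ((t ^ i : kˣ) : k) • ((modulePoint k R M).rep r * g)) :
    IsGradable 𝒜 M := by
  let e := LinearMap.toMatrixAlgEquiv (Module.finBasis k M)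
  have hu : IsUnit (e.symm g) := hg.map e.symm
  refine isGradable_of_twist 𝒜 hs hN t ht (e.symm g)
    ((Module.End.isUnit_iff _).mp hu).1 fun i r hr m => ?_
  have h1 := congrArg e.symm (h i r hr)
  have h2 : e.symm ((modulePoint k R M).rep r) = Algebra.lsmul k k M r :=
    e.symm_apply_apply _
  rw [map_mul, map_smul, map_mul, h2] at h1
  exact LinearMap.congr_fun h1 m

theorem HasOpenOrbit.isGradable [Algebra.FiniteType k R] (h : HasOpenOrbit k R M) :
    IsGradable 𝒜 M := by
  obtain ⟨s, hs⟩ := Algebra.FiniteType.out (R := k) (A := R)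
  obtain ⟨N, hN⟩ := exists_degree_bound 𝒜 s
  have h1 := (modulePoint k R M).tendsto_twist 𝒜 (h.mem_nhds (MulAction.mem_orbit_self _))
  have h2 : ∀ᶠ t in Filter.cofinite, (modulePoint k R M).twist 𝒜 t ∈
    MulAction.orbit (GL (Fin (Module.finrank k M)) k) (modulePoint k R M) := h1
  have : Infinite kˣ := by
    by_contra hfin
    rw [not_infinite_iff_finite] at hfin
    refine Set.infinite_univ (α := k) (((Set.finite_range (Units.val (α := k))).insert 0).subset ?_)
    intro x _
    by_cases hx : x = 0
    · exact Or.inl hx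
    · exact Or.inr ⟨Units.mk0 x hx, rfl⟩
  obtain ⟨t, ⟨g, hg⟩, ht⟩ :=
    (h2.and (eventually_pow_ne_one ((Module.finrank k M + 1) * N))).exists
  refine isGradable_of_matrix 𝒜 hs hN t ht g.val g.isUnit fun i r hr => ?_
  have h2 : g.val * (modulePoint k R M).rep r * (g⁻¹).val =
      (modulePoint k R M).rep (gradedTwist 𝒜 t r) :=
    congrArg (fun x => ModuleVariety.rep x r) hg
  rw [gradedTwist_of_mem 𝒜 t hr, map_smul] at h2
  rw [← smul_mul_assoc, ← h2, mul_assoc, Units.inv_mul, mul_one]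

end OpenOrbit

/-! ### Self-extensions and inner derivations -/

section DerivationExtension

variable {k : Type w} {R : Type u} {M : Type v} [Field k] [Ring R] [Algebra k R]
  [AddCommGroup M] [Module k M] [Module R M] [IsScalarTower k R M]

/-- The extension of `M` by itself given by a derivation `D : R → End M`: the abelian group
`M × M` with `r • (x, y) = (r • x + D r y, r • y)`. -/
def DerivationExtension (_D : R →ₗ[k] Module.End k M)
    (_hD : ∀ r s, _D (r * s) = _D r * Algebra.lsmul k k M s + Algebra.lsmul k k M r * _D s) :
    Type v :=
  M × M

namespace DerivationExtension

variable (D : R →ₗ[k] Module.End k M)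
  (hD : ∀ r s, D (r * s) = D r * Algebra.lsmul k k M s + Algebra.lsmul k k M r * D s)

instance : AddCommGroup (DerivationExtension D hD) := inferInstanceAs (AddCommGroup (M × M))

instance : Module R (DerivationExtension D hD) where
  smul r x := ((r • x.1 + D r x.2, r • x.2) : M × M)
  one_smul x := by
    have h1 : D 1 = 0 := by simpa using hD 1 1
    refine Prod.ext ?_ ?_
    · change (1 : R) • x.1 + D 1 x.2 = x.1
      simp [h1]
    · exact one_smul R x.2
  mul_smul r s x := by
    refine Prod.ext ?_ ?_
    · change (r * s) • x.1 + D (r * s) x.2 = r • (s • x.1 + D s x.2) + D r (s • x.2)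
      rw [hD, smul_add, mul_smul]
      simp only [LinearMap.add_apply, Module.End.mul_apply, Algebra.lsmul_coe]
      abel
    · exact mul_smul r s x.2
  smul_zero r := by
    refine Prod.ext ?_ ?_
    · change r • (0 : M) + D r 0 = 0
      simp
    · exact smul_zero r
  smul_add r x y := by
    refine Prod.ext ?_ ?_
    · change r • (x.1 + y.1) + D r (x.2 + y.2) = (r • x.1 + D r x.2) + (r • y.1 + D r y.2)
      rw [smul_add, map_add]
      abel
    · exact smul_add r x.2 y.2
  add_smul r s x := by
    refine Prod.ext ?_ ?_
    · change (r + s) • x.1 + D (r + s) x.2 = (r • x.1 + D r x.2) + (s • x.1 + D s x.2)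
      rw [add_smul, map_add, LinearMap.add_apply]
      abel
    · exact add_smul r s x.2
  zero_smul x := by
    refine Prod.ext ?_ ?_
    · change (0 : R) • x.1 + D 0 x.2 = 0
      simp
    · exact zero_smul R x.2

/-- The inclusion of the submodule. -/
def incl : M →ₗ[R] DerivationExtension D hD where
  toFun x := ((x, 0) : M × M)
  map_add' x y := Prod.ext rfl (add_zero (0 : M)).symm
  map_smul' r x := by
    refine Prod.ext ?_ (smul_zero r).symm
    change r • x = r • x + D r 0
    simp

/-- The projection to the quotient module. -/
def proj : DerivationExtension D hD →ₗ[R] M where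
  toFun x := x.2
  map_add' _ _ := rfl
  map_smul' _ _ := rfl

/-- The extension as a short complex. -/
noncomputable def shortComplex : ShortComplex (ModuleCat.{v} R) :=
  ShortComplex.mk (ModuleCat.ofHom (incl D hD)) (ModuleCat.ofHom (proj D hD)) rfl

theorem shortExact : (shortComplex D hD).ShortExact where
  exact := by
    rw [ShortComplex.ShortExact.moduleCat_exact_iff_function_exact]
    intro x
    constructor
    · intro hx
      exact ⟨x.1, Prod.ext rfl (Eq.symm hx)⟩
    · rintro ⟨y, rfl⟩
      rfl
  mono_f := (ModuleCat.mono_iff_injective _).mpr fun _ _ h => congrArg Prod.fst h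
  epi_g := (ModuleCat.epi_iff_surjective _).mpr fun y => ⟨((0, y) : M × M), rfl⟩

end DerivationExtension

/-- The extension defined by `D` splits. A section has the form `m ↦ (X m, m)`, and its
`R`-linearity says `X (r • m) = r • X m + D r m`. -/
theorem derivation_inner_of_subsingleton_ext [Small.{v} R]
    (h : Subsingleton (Abelian.Ext.{v} (ModuleCat.of R M) (ModuleCat.of R M) 1))
    (D : R →ₗ[k] Module.End k M)
    (hD : ∀ r s, D (r * s) = D r * Algebra.lsmul k k M s + Algebra.lsmul k k M r * D s) :
    ∃ X : Module.End k M, ∀ r, D r = X * Algebra.lsmul k k M r - Algebra.lsmul k k M r * X := by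
  -- The obstruction to lifting the identity of `M` along the projection lies in the vanishing
  -- group.
  obtain ⟨x, hx⟩ := Abelian.Ext.covariant_sequence_exact₃ (ModuleCat.of R M)
    (DerivationExtension.shortExact D hD) (Abelian.Ext.mk₀ (𝟙 (ModuleCat.of R M))) (zero_add 1)
    (h.elim _ _)
  obtain ⟨f, rfl⟩ := (Abelian.Ext.mk₀_bijective _ _).2 x
  rw [Abelian.Ext.mk₀_comp_mk₀] at hx
  have hf := (Abelian.Ext.mk₀_bijective _ _).1 hx
  let σ : M →ₗ[R] DerivationExtension D hD := f.hom
  have hσ : ∀ m, (σ m).2 = m := fun m => congrArg (fun φ => φ.hom m) hf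
  have hfst : ∀ (r : R) (m : M), (σ (r • m)).1 = r • (σ m).1 + D r m := by
    intro r m
    have h1 : (σ (r • m)).1 = r • (σ m).1 + D r (σ m).2 := congrArg Prod.fst (σ.map_smul r m)
    rwa [hσ] at h1
  -- Since `D` kills scalars, `X` is `k`-linear.
  have hDk : ∀ c : k, D (algebraMap k R c) = 0 := by
    intro c
    have h1 : D 1 = 0 := by simpa using hD 1 1
    rw [Algebra.algebraMap_eq_smul_one, map_smul, h1, smul_zero]
  refine ⟨{ toFun := fun m => (σ m).1
            map_add' := fun x y => congrArg Prod.fst (σ.map_add x y)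
            map_smul' := fun c m => ?_ }, fun r => LinearMap.ext fun m => ?_⟩
  · have := hfst (algebraMap k R c) m
    rw [hDk, algebraMap_smul, algebraMap_smul] at this
    simpa using this
  · have := hfst r m
    exact eq_sub_of_add_eq ((add_comm _ _).trans this.symm)

end DerivationExtension

/-! ### Formal conjugation by successive coefficients -/

section Series

open Finset.HasAntidiagonal

theorem sum_antidiagonal_antidiagonal {A : Type*} [AddCommMonoid A] (n : ℕ)
    (f : ℕ → ℕ → ℕ → A) :
    ∑ p ∈ antidiagonal n, ∑ q ∈ antidiagonal p.1, f q.1 q.2 p.2 =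
      ∑ p ∈ antidiagonal n, ∑ q ∈ antidiagonal p.2, f p.1 q.1 q.2 := by
  simp only [Finset.sum_sigma']
  apply Finset.sum_nbij' (fun x => ⟨(x.2.1, x.2.2 + x.1.2), (x.2.2, x.1.2)⟩)
    (fun x => ⟨(x.1.1 + x.2.1, x.2.2), (x.1.1, x.2.1)⟩)
  · rintro ⟨⟨a, b⟩, ⟨c, d⟩⟩ h
    simp only [Finset.mem_sigma, mem_antidiagonal] at h ⊢
    obtain ⟨rfl, rfl⟩ := h
    exact ⟨by ring, trivial⟩
  · rintro ⟨⟨a, b⟩, ⟨c, d⟩⟩ h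
    simp only [Finset.mem_sigma, mem_antidiagonal] at h ⊢
    obtain ⟨rfl, rfl⟩ := h
    exact ⟨by ring, trivial⟩
  · rintro ⟨⟨a, b⟩, ⟨c, d⟩⟩ h
    simp only [Finset.mem_sigma, mem_antidiagonal] at h
    obtain ⟨rfl, rfl⟩ := h
    rfl
  · rintro ⟨⟨a, b⟩, ⟨c, d⟩⟩ h
    simp only [Finset.mem_sigma, mem_antidiagonal] at h
    obtain ⟨rfl, rfl⟩ := h
    rfl
  · intro x _
    rfl

variable {k R A : Type*} [Field k] [Ring R] [Algebra k R] (𝒜 : ℤ → Submodule k R)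
  [GradedAlgebra 𝒜] [Ring A] [Algebra k A] (ρ : R →ₐ[k] A) (u : (PowerSeries k)ˣ)

/-- The coefficients of the automorphism of `R⟦X⟧` that multiplies the elements of degree `i` of
`R` by `u ^ i`. -/
noncomputable def hasseScale (m : ℕ) : R →ₗ[k] R :=
  gradedScale 𝒜 fun i => PowerSeries.coeff m ((u ^ i : (PowerSeries k)ˣ) : PowerSeries k)

theorem hasseScale_mul (m : ℕ) (r s : R) : hasseScale 𝒜 u m (r * s) =
    ∑ p ∈ antidiagonal m, hasseScale 𝒜 u p.1 r * hasseScale 𝒜 u p.2 s := by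
  have := bilinear_ext_of_homogeneous 𝒜 ((LinearMap.mul k R).compr₂ (hasseScale 𝒜 u m))
    (∑ p ∈ antidiagonal m,
      (LinearMap.mul k R).compl₁₂ (hasseScale 𝒜 u p.1) (hasseScale 𝒜 u p.2))
    (fun i j r hr s hs => by
      simp only [hasseScale, LinearMap.compr₂_apply, LinearMap.sum_apply,
        LinearMap.compl₁₂_apply, LinearMap.mul_apply', gradedScale_of_mem 𝒜 _ hr,
        gradedScale_of_mem 𝒜 _ hs, gradedScale_of_mem 𝒜 _ (SetLike.GradedMul.mul_mem hr hs),
        zpow_add, Units.val_mul, smul_mul_smul_comm, PowerSeries.coeff_mul, Finset.sum_smul]) r s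
  simpa only [LinearMap.compr₂_apply, LinearMap.sum_apply, LinearMap.compl₁₂_apply,
    LinearMap.mul_apply'] using this

theorem hasseScale_zero (hu : PowerSeries.constantCoeff (u : PowerSeries k) = 1) (r : R) :
    hasseScale 𝒜 u 0 r = r := by
  have h : ∀ i : ℤ, PowerSeries.coeff 0 ((u ^ i : (PowerSeries k)ˣ) : PowerSeries k) = 1 := by
    intro i
    rw [PowerSeries.coeff_zero_eq_constantCoeff_apply]
    have h1 : Units.map (PowerSeries.constantCoeff (R := k)).toMonoidHom u = 1 := Units.ext hu
    have h2 := congrArg Units.val (map_zpow (Units.map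
      (PowerSeries.constantCoeff (R := k)).toMonoidHom) u i)
    rw [h1, one_zpow] at h2
    exact h2
  suffices hasseScale 𝒜 u 0 = LinearMap.id by rw [this]; rfl
  refine DirectSum.decompose_lhom_ext 𝒜 fun i => LinearMap.ext fun r => ?_
  simp only [hasseScale, LinearMap.comp_apply, Submodule.subtype_apply,
    gradedScale_of_mem 𝒜 _ r.2, h, one_smul, LinearMap.id_apply]

/-- The obstruction to extending a solution `G 0, …, G n` of the conjugation equations by one
more coefficient. -/
noncomputable def hasseObstruction (G : ℕ → A) (n : ℕ) : R →ₗ[k] A :=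
  ∑ p ∈ antidiagonal n,
    LinearMap.mulRight k (G p.2) ∘ₗ ρ.toLinearMap ∘ₗ hasseScale 𝒜 u (p.1 + 1)

theorem hasseObstruction_apply (G : ℕ → A) (n : ℕ) (r : R) : hasseObstruction 𝒜 ρ u G n r =
    ∑ p ∈ antidiagonal n, ρ (hasseScale 𝒜 u (p.1 + 1) r) * G p.2 := by
  simp [hasseObstruction]

theorem sum_hasseScale_succ (hu : PowerSeries.constantCoeff (u : PowerSeries k) = 1)
    (G : ℕ → A) (n : ℕ) (r : R) :
    ∑ p ∈ antidiagonal (n + 1), ρ (hasseScale 𝒜 u p.1 r) * G p.2 =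
      ρ r * G (n + 1) + hasseObstruction 𝒜 ρ u G n r := by
  rw [Finset.Nat.sum_antidiagonal_succ, hasseObstruction_apply, hasseScale_zero 𝒜 u hu]

/-- Expand the coefficient of index `n + 1` for `r * s` using multiplicativity of the rescaling. The
equations up to `n` turn the inner sums into `G m * ρ s`, and the terms `ρ r * ρ s * G (n + 1)`
cancel. -/
theorem hasseObstruction_mul (hu : PowerSeries.constantCoeff (u : PowerSeries k) = 1)
    (G : ℕ → A) (n : ℕ)
    (hG : ∀ m ≤ n, ∀ r, G m * ρ r =
      ∑ p ∈ antidiagonal m, ρ (hasseScale 𝒜 u p.1 r) * G p.2) (r s : R) :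
    hasseObstruction 𝒜 ρ u G n (r * s) =
      hasseObstruction 𝒜 ρ u G n r * ρ s + ρ r * hasseObstruction 𝒜 ρ u G n s := by
  have h1 : ∑ p ∈ antidiagonal (n + 1), ρ (hasseScale 𝒜 u p.1 (r * s)) * G p.2 =
      ∑ p ∈ antidiagonal (n + 1), ρ (hasseScale 𝒜 u p.1 r) *
        ∑ q ∈ antidiagonal p.2, ρ (hasseScale 𝒜 u q.1 s) * G q.2 := by
    simp only [hasseScale_mul, map_sum, map_mul, Finset.sum_mul, Finset.mul_sum, mul_assoc]
    exact sum_antidiagonal_antidiagonal (n + 1) fun a b c =>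
      ρ (hasseScale 𝒜 u a r) * (ρ (hasseScale 𝒜 u b s) * G c)
  rw [sum_hasseScale_succ 𝒜 ρ u hu, Finset.Nat.sum_antidiagonal_succ,
    sum_hasseScale_succ 𝒜 ρ u hu, hasseScale_zero 𝒜 u hu] at h1
  have h2 : ∑ p ∈ antidiagonal n, ρ (hasseScale 𝒜 u (p.1 + 1) r) *
      ∑ q ∈ antidiagonal p.2, ρ (hasseScale 𝒜 u q.1 s) * G q.2 =
      hasseObstruction 𝒜 ρ u G n r * ρ s := by
    rw [hasseObstruction_apply, Finset.sum_mul]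
    refine Finset.sum_congr rfl fun p hp => ?_
    rw [← hG p.2 (antidiagonal.snd_le hp), mul_assoc]
  rw [h2, map_mul, mul_add, ← mul_assoc, add_assoc] at h1
  rw [add_left_cancel h1, add_comm]

/-- The equation for `G (n + 1)` asks that its commutator with `ρ` be the obstruction. The latter is
a derivation, hence inner by `H`. -/
theorem exists_conjugating_series (hu : PowerSeries.constantCoeff (u : PowerSeries k) = 1)
    (H : ∀ D : R →ₗ[k] A, (∀ r s, D (r * s) = D r * ρ s + ρ r * D s) →
      ∃ X : A, ∀ r, D r = X * ρ r - ρ r * X) :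
    ∃ G : ℕ → A, G 0 = 1 ∧ ∀ m r, G m * ρ r =
      ∑ p ∈ antidiagonal m, ρ (hasseScale 𝒜 u p.1 r) * G p.2 := by
  -- Choosing `X` for every linear map lets the recursion be defined before the obstructions are
  -- known to be derivations.
  have H' : ∀ D : R →ₗ[k] A, ∃ X : A, (∀ r s, D (r * s) = D r * ρ s + ρ r * D s) →
      ∀ r, D r = X * ρ r - ρ r * X := by
    intro D
    by_cases hD : ∀ r s, D (r * s) = D r * ρ s + ρ r * D s
    · obtain ⟨X, hX⟩ := H D hD
      exact ⟨X, fun _ => hX⟩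
    · exact ⟨0, fun h => (hD h).elim⟩
  choose X hX using H'
  let F : ℕ → ℕ → A := fun n => Nat.rec (fun _ => 1)
    (fun n G => Function.update G (n + 1) (X (hasseObstruction 𝒜 ρ u G n))) n
  have hF : ∀ n, F (n + 1) =
    Function.update (F n) (n + 1) (X (hasseObstruction 𝒜 ρ u (F n) n)) := fun n => rfl
  have hstab : ∀ n m, m ≤ n → F n m = F m m := by
    intro n
    induction n with
    | zero => intro m hm; rw [Nat.le_zero.mp hm]
    | succ n ih =>
      intro m hm
      rcases Nat.lt_or_eq_of_le hm with h | rfl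
      · rw [hF, Function.update_of_ne (by omega), ih m (by omega)]
      · rfl
  let G : ℕ → A := fun n => F n n
  have hobs : ∀ n, hasseObstruction 𝒜 ρ u (F n) n = hasseObstruction 𝒜 ρ u G n := by
    intro n
    ext r
    rw [hasseObstruction_apply, hasseObstruction_apply]
    refine Finset.sum_congr rfl fun p hp => ?_
    rw [hstab n p.2 (antidiagonal.snd_le hp)]
  have hGs : ∀ n, G (n + 1) = X (hasseObstruction 𝒜 ρ u G n) := by
    intro n
    simp only [G, hF, Function.update_self]
    rw [hobs]
  refine ⟨G, rfl, fun m => ?_⟩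
  induction m using Nat.strong_induction_on with
  | _ m ih =>
    intro r
    cases m with
    | zero => simp [hasseScale_zero 𝒜 u hu, G, F]
    | succ n =>
      have h1 := hX _ (hasseObstruction_mul 𝒜 ρ u hu G n fun m hm => ih m (by omega)) r
      rw [sum_hasseScale_succ 𝒜 ρ u hu, h1, hGs]
      abel

end Series

/-! ### Specialization to the base field -/

section Specialization

variable {k : Type*} [Field k] [IsAlgClosed k]

/-- Nullstellensatz: the residue field at a maximal ideal is finite over `k`, hence equal to `k`. -/
theorem exists_algHom_adjoin {K : Type*} [Field K] [Algebra k K] (T : Set K) (hT : T.Finite) :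
    Nonempty (Algebra.adjoin k T →ₐ[k] k) := by
  have : Algebra.FiniteType k (Algebra.adjoin k T) :=
    (Subalgebra.fg_iff_finiteType _).mp (Subalgebra.fg_def.mpr ⟨T, hT, rfl⟩)
  obtain ⟨m, hm⟩ := Ideal.exists_maximal (Algebra.adjoin k T)
  let := Ideal.Quotient.field m
  have := finite_of_finite_type_of_isJacobsonRing k (Algebra.adjoin k T ⧸ m)
  let e : k ≃ₐ[k] (Algebra.adjoin k T ⧸ m) :=
    AlgEquiv.ofBijective (Algebra.ofId _ _) IsAlgClosed.algebraMap_bijective_of_isIntegral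
  exact ⟨e.symm.toAlgHom.comp (Ideal.Quotient.mkₐ k m)⟩

/-- A conjugation of a family of matrices over `k` into its multiples by powers of a unit,
defined over an extension field of `k`, specializes to `k`. -/
theorem exists_specialization {K : Type*} [Field K] [Algebra k K] {d : ℕ} {E : Type*}
    (deg : E → ℤ) (a : E → Matrix (Fin d) (Fin d) k) (t : Kˣ) (L : ℕ)
    (ht : ∀ n, 0 < n → n ≤ L → t ^ n ≠ 1) (g : Matrix (Fin d) (Fin d) K) (hg : IsUnit g)
    (h : ∀ e, g * (a e).map (algebraMap k K) =
      ((t ^ deg e : Kˣ) : K) • ((a e).map (algebraMap k K) * g)) :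
    ∃ (t' : kˣ) (g' : Matrix (Fin d) (Fin d) k), (∀ n, 0 < n → n ≤ L → t' ^ n ≠ 1) ∧
      IsUnit g' ∧ ∀ e, g' * a e = ((t' ^ deg e : kˣ) : k) • (a e * g') := by
  -- Inverting `P` and `g.det` in the finitely generated algebra keeps the order condition and the
  -- invertibility of `g` under any homomorphism to `k`.
  let P : K := ∏ n ∈ Finset.Icc 1 L, ((t : K) ^ n - 1)
  have hP : P ≠ 0 := by
    refine Finset.prod_ne_zero_iff.mpr fun n hn => sub_ne_zero.mpr fun h' => ?_
    rw [Finset.mem_Icc] at hn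
    exact ht n hn.1 hn.2 (Units.ext (by simpa using h'))
  have hdet : g.det ≠ 0 := ((Matrix.isUnit_iff_isUnit_det g).mp hg).ne_zero
  let T : Set K := Set.range (fun x : Fin d × Fin d => g x.1 x.2) ∪
    {(t : K), ((t⁻¹ : Kˣ) : K), g.det⁻¹, P⁻¹}
  have hT : T.Finite := (Set.finite_range _).union (Set.toFinite _)
  obtain ⟨φ⟩ := exists_algHom_adjoin (k := k) T hT
  let B := Algebra.adjoin k T
  have hmem : ∀ x ∈ T, x ∈ B := fun x hx => Algebra.subset_adjoin hx
  let gB : Matrix (Fin d) (Fin d) B := fun i j => ⟨g i j, hmem _ (Or.inl ⟨(i, j), rfl⟩)⟩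
  let tB : Bˣ :=
    { val := ⟨t, hmem _ (Or.inr (by simp))⟩
      inv := ⟨((t⁻¹ : Kˣ) : K), hmem _ (Or.inr (by simp))⟩
      val_inv := Subtype.ext (Units.mul_inv t)
      inv_val := Subtype.ext (Units.inv_mul t) }
  let δ : B := ⟨g.det⁻¹, hmem _ (Or.inr (by simp))⟩
  let η : B := ⟨P⁻¹, hmem _ (Or.inr (by simp))⟩
  have hgB : gB.map B.val = g := rfl
  have htB : Units.map (B.val : B →* K) tB = t := Units.ext rfl
  have hδ : gB.det * δ = 1 := by
    apply Subtype.val_injective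
    change B.val (gB.det * δ) = 1
    rw [map_mul, AlgHom.map_det]
    exact mul_inv_cancel₀ hdet
  have hη : (∏ n ∈ Finset.Icc 1 L, ((tB : B) ^ n - 1)) * η = 1 := by
    apply Subtype.val_injective
    change B.val (_ * η) = 1
    rw [map_mul, map_prod]
    simp only [map_sub, map_pow, map_one]
    exact mul_inv_cancel₀ hP
  have hB : ∀ e, gB * (a e).map (algebraMap k B) =
      ((tB ^ deg e : Bˣ) : B) • ((a e).map (algebraMap k B) * gB) := by
    intro e
    apply Matrix.map_injective (f := B.val) Subtype.val_injective
    have h1 : ((a e).map (algebraMap k B)).map B.val = (a e).map (algebraMap k K) := rfl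
    have h2 : B.val ((tB ^ deg e : Bˣ) : B) = ((t ^ deg e : Kˣ) : K) := by
      rw [← htB, ← map_zpow]; rfl
    change (gB * (a e).map (algebraMap k B)).map (B.val : B →+* K) =
      (((tB ^ deg e : Bˣ) : B) • ((a e).map (algebraMap k B) * gB)).map (B.val : B →+* K)
    rw [Matrix.map_mul, Matrix.map_smul' _ _ _ (map_mul _), Matrix.map_mul]
    exact (h e).trans (by rw [← h2]; rfl)
  refine ⟨Units.map (φ : B →* k) tB, gB.map φ, ?_, ?_, ?_⟩
  · intro n hn hnL hcon
    have h1 := congrArg φ hη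
    rw [map_mul, map_prod, map_one, Finset.prod_eq_zero (Finset.mem_Icc.mpr ⟨hn, hnL⟩),
      zero_mul] at h1
    · exact zero_ne_one h1
    · have h2 := congrArg Units.val hcon
      rw [map_sub, map_pow, map_one, sub_eq_zero]
      exact h2
  · rw [Matrix.isUnit_iff_isUnit_det]
    have h1 := congrArg φ hδ
    rw [map_mul, AlgHom.map_det, map_one] at h1
    exact IsUnit.of_mul_eq_one _ h1
  · intro e
    have h1 := congrArg (fun m => m.map (φ : B →+* k)) (hB e)
    rw [Matrix.map_mul, Matrix.map_smul' _ _ _ (map_mul _), Matrix.map_mul] at h1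
    have h2 : ((a e).map (algebraMap k B)).map (φ : B →+* k) = a e := by
      ext i j
      exact φ.commutes _
    rw [h2] at h1
    rw [← map_zpow]
    exact h1

end Specialization

/-! ### Modules without self-extensions -/

section Rigid

variable {k R : Type*} [Field k] [Ring R] [Algebra k R] (𝒜 : ℤ → Submodule k R)
  [GradedAlgebra 𝒜]

/-- The unit `1 + X` of the ring of power series. -/
noncomputable def onePlusX (k : Type*) [Field k] : (PowerSeries k)ˣ :=
  IsUnit.unit (a := (1 + PowerSeries.X : PowerSeries k))
    (PowerSeries.isUnit_iff_constantCoeff.mpr (by simp))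

theorem onePlusX_val : (onePlusX k : PowerSeries k) = 1 + PowerSeries.X := rfl

/-- The coefficient of `X ^ n` in `(1 + X) ^ n` is `1` in every characteristic. -/
theorem onePlusX_pow_ne_one (n : ℕ) (hn : 0 < n) : (onePlusX k) ^ n ≠ 1 := by
  intro h
  have h1 := congrArg (fun x : (PowerSeries k)ˣ => PowerSeries.coeff n (x : PowerSeries k)) h
  have h2 : ((1 + PowerSeries.X : PowerSeries k)) ^ n =
      (((1 + Polynomial.X) ^ n : Polynomial k) : PowerSeries k) := by simp
  simp only [Units.val_pow_eq_pow_val, onePlusX_val, h2, Polynomial.coeff_coe,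
    Polynomial.coeff_one_add_X_pow, Nat.choose_self, Units.val_one, PowerSeries.coeff_one,
    hn.ne', if_false, Nat.cast_one] at h1
  exact one_ne_zero h1

theorem exists_power_series_conjugation {d : ℕ} (ρ : R →ₐ[k] Matrix (Fin d) (Fin d) k)
    (H : ∀ D : R →ₗ[k] Matrix (Fin d) (Fin d) k,
      (∀ r s, D (r * s) = D r * ρ s + ρ r * D s) → ∃ X, ∀ r, D r = X * ρ r - ρ r * X)
    (u : (PowerSeries k)ˣ) (hu : PowerSeries.constantCoeff (u : PowerSeries k) = 1) :
    ∃ g : Matrix (Fin d) (Fin d) (PowerSeries k), IsUnit g ∧ ∀ i : ℤ, ∀ r ∈ 𝒜 i,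
      g * (ρ r).map (PowerSeries.C (R := k)) =
        ((u ^ i : (PowerSeries k)ˣ) : PowerSeries k) •
          ((ρ r).map (PowerSeries.C (R := k)) * g) := by
  obtain ⟨G, hG0, hG⟩ := exists_conjugating_series 𝒜 ρ u hu H
  refine ⟨Matrix.of fun a b => PowerSeries.mk fun n => G n a b, ?_, fun i r hr => ?_⟩
  -- The determinant has constant term `det (G 0) = 1`.
  · rw [Matrix.isUnit_iff_isUnit_det, PowerSeries.isUnit_iff_constantCoeff, RingHom.map_det]
    convert isUnit_one (M := k)
    rw [← Matrix.det_one (n := Fin d) (R := k), ← hG0]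
    rfl
  · ext a b n
    have h1 := congrFun (congrFun (hG n r) a) b
    simp only [hasseScale, gradedScale_of_mem 𝒜 _ hr, map_smul, smul_mul_assoc,
      Matrix.sum_apply, Matrix.smul_apply, smul_eq_mul] at h1
    rw [Matrix.smul_apply, smul_eq_mul, PowerSeries.coeff_mul]
    simp only [Matrix.mul_apply, Matrix.map_apply, Matrix.of_apply, map_sum, PowerSeries.coeff_mul_C,
      PowerSeries.coeff_C_mul, PowerSeries.coeff_mk] at h1 ⊢
    exact h1

end Rigid

theorem isGradable_of_subsingleton_ext {k : Type w} {R : Type u} {M : Type v} [Field k]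
    [IsAlgClosed k] [Ring R] [Algebra k R] [Algebra.FiniteType k R]
    (𝒜 : ℤ → Submodule k R) [GradedAlgebra 𝒜] [AddCommGroup M] [Module k M] [Module R M]
    [IsScalarTower k R M] [FiniteDimensional k M] [Small.{v} R]
    (h : Subsingleton (Abelian.Ext.{v} (ModuleCat.of R M) (ModuleCat.of R M) 1)) :
    IsGradable 𝒜 M := by
  obtain ⟨s, hs⟩ := Algebra.FiniteType.out (R := k) (A := R)
  obtain ⟨N, hN⟩ := exists_degree_bound 𝒜 s
  let ε := LinearMap.toMatrixAlgEquiv (Module.finBasis k M)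
  have hε : ∀ r, ε (Algebra.lsmul k k M r) = (modulePoint k R M).rep r := fun r => rfl
  obtain ⟨g, hg, hconj⟩ := exists_power_series_conjugation 𝒜 (modulePoint k R M).rep
    (fun D hD => by
      obtain ⟨X, hX⟩ := derivation_inner_of_subsingleton_ext h
        (ε.symm.toLinearMap ∘ₗ D) (fun r s => by
          apply ε.injective
          simp [hD, hε])
      refine ⟨ε X, fun r => ?_⟩
      have := congrArg ε (hX r)
      simpa [hε] using this)
    (onePlusX k) (by simp [onePlusX_val])
  let ι := algebraMap (PowerSeries k) (FractionRing (PowerSeries k))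
  have hι : Function.Injective ι := FaithfulSMul.algebraMap_injective _ _
  have hC : ∀ c : k, ι (PowerSeries.C c) = algebraMap k (FractionRing (PowerSeries k)) c := fun c =>
    (IsScalarTower.algebraMap_apply k (PowerSeries k) (FractionRing (PowerSeries k)) c).symm
  obtain ⟨t, g', ht, hg', h'⟩ := exists_specialization (k := k) (K := FractionRing (PowerSeries k))
    (E := Σ i : ℤ, 𝒜 i) (fun e => e.1) (fun e => (modulePoint k R M).rep e.2)
    (Units.map (ι : PowerSeries k →* FractionRing (PowerSeries k)) (onePlusX k))
    ((Module.finrank k M + 1) * N)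
    (fun n hn _ hcon => onePlusX_pow_ne_one (k := k) n hn (by
      rw [← map_pow] at hcon
      exact Units.map_injective (f := (ι : PowerSeries k →* FractionRing (PowerSeries k))) hι
        (hcon.trans (map_one _).symm)))
    (ι.mapMatrix g) (hg.map ι.mapMatrix)
    (fun e => by
      have h1 := congrArg (fun m => m.map ι) (hconj e.1 e.2 e.2.2)
      rw [Matrix.map_mul, Matrix.map_smul' _ _ _ (map_mul _), Matrix.map_mul] at h1
      have h2 : (((modulePoint k R M).rep e.2).map (PowerSeries.C (R := k))).map ι =
          ((modulePoint k R M).rep e.2).map (algebraMap k (FractionRing (PowerSeries k))) := by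
        ext1 a b
        exact hC _
      rw [h2] at h1
      rw [← map_zpow]
      exact h1)
  exact isGradable_of_matrix 𝒜 hs hN t ht g' hg' fun i r hr => h' ⟨i, r, hr⟩

theorem mainTheorem3 {k : Type w} {R : Type u} {M : Type v} [Field k] [IsAlgClosed k]
    [Ring R] [Algebra k R] [Algebra.FiniteType k R]
    (𝒜 : ℤ → Submodule k R) [GradedAlgebra 𝒜]
    [AddCommGroup M] [Module k M] [Module R M] [IsScalarTower k R M] [FiniteDimensional k M]
    [Small.{v} R] :
    (HasOpenOrbit k R M → IsGradable 𝒜 M) ∧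
      (Subsingleton (Abelian.Ext.{v} (ModuleCat.of R M) (ModuleCat.of R M) 1) →
        IsGradable 𝒜 M) :=
  ⟨HasOpenOrbit.isGradable 𝒜, isGradable_of_subsingleton_ext 𝒜⟩
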